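/- Let $n \ge 1$, let $x_1 < x_2 < \cdots < x_n$ and $y_1 < y_2 < \cdots < y_n$ be real numbers, and let $A = [e^{x_i y_j}]_{i,j=1,\ldots,n}$. Put $V(\mathbf{x}) = \prod_{1 \le i < j \le n} (x_j - x_i)$, $V(\mathbf{y}) = \prod_{1 \le i < j \le n} (y_j - y_i)$ and $c_n = \prod_{i=1}^{n-1} i!$ (empty products being $1$). Then $$\det(A) \ge \frac{1}{c_n} V(\mathbf{x}) V(\mathbf{y})\, e^{(x_1 + \cdots + x_n)(y_1 + \cdots + y_n)/n}$$ and $$\det(A) \le \frac{1}{c_n} V(\mathbf{x}) V(\mathbf{y})\, e^{x_1 y_1 + \cdots + x_n y_n}.$$ -/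

import Mathlib

/-- The exponential matrix `[e^{x_i y_j}]`. -/
noncomputable def expMatrix {n : ℕ} (x y : Fin n → ℝ) : Matrix (Fin n) (Fin n) ℝ :=
  Matrix.of fun i j => Real.exp (x i * y j)

/-- The Vandermonde polynomial `V(x) = ∏_{i < j} (x_j - x_i)`. -/
def vandermondePoly {n : ℕ} (x : Fin n → ℝ) : ℝ :=
  ∏ i : Fin n, ∏ j ∈ Finset.Ioi i, (x j - x i)

/-- The constant `c_n = ∏_{i=1}^{n-1} i!`. -/
def superfactConst (n : ℕ) : ℕ :=
  ∏ i ∈ Finset.Icc 1 (n - 1), i.factorial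

/-!
Induction on the number of nodes. Subtracting `y_1` from every `y_j` makes the first column of the
matrix constant, up to a factor `e^{x_i y_1}` in each row, so by the fundamental theorem of calculus
`det [e^{x_i y_j}]` is an integral of the same determinant with one node fewer, over the box of
points `t` interlacing `x`. The Vandermonde polynomial satisfies the same kind of recursion, so only
the exponential factor has to be estimated on the box. For the upper bound, `t_i ≤ x_{i+1}`. For
the lower bound, Jensen's inequality with density `V(t)` reduces the claim to the mean of
`t_1 + ⋯ + t_{n-1}`, which is read off the recursion for the determinant of the powers of the nodes
with exponents `0, 1, …, n - 2, n`, since this determinant equals `(x_1 + ⋯ + x_n) V(x)`.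
-/

open MeasureTheory Matrix

section Determinants

variable {R : Type*} [CommRing R] {n : ℕ}

theorem det_eq_det_sub_of_col_zero_eq_one (A : Matrix (Fin (n + 1)) (Fin (n + 1)) R)
    (hA : ∀ i, A i 0 = 1) :
    A.det = (of fun i j : Fin n => A i.succ j.succ - A i.castSucc j.succ).det := by
  let B : Matrix (Fin (n + 1)) (Fin (n + 1)) R :=
    of (Fin.cons (A 0) fun i j => A i.succ j - A i.castSucc j)
  have hAB : A.det = B.det :=
    det_eq_of_forall_row_eq_smul_add_pred (fun _ => 1) (fun j => by simp [B])
      fun i j => by simp [B]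
  have hB0 : ∀ i : Fin n, B i.succ 0 = 0 := fun i => by simp [B, hA]
  rw [hAB, det_succ_column_zero, Fin.sum_univ_succ, Finset.sum_eq_zero fun i _ => by simp [hB0]]
  have hB00 : B 0 0 = 1 := by simp [B, hA]
  simp only [Fin.val_zero, pow_zero, hB00, one_mul, add_zero, Fin.succAbove_zero]
  rfl

/-- The generalized Vandermonde matrix `[v_i ^ a_j]`, with arbitrary exponents `a`. It puts the
Vandermonde determinant and its product with the sum of the nodes under one integral recursion. -/
def generalizedVandermonde {m k M : Type*} [Monoid M] (v : m → M) (a : k → ℕ) : Matrix m k M :=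
  of fun i j => v i ^ a j

theorem pow_eq_sum_neg_coeff_prod_X_sub_C (v : Fin n → R) (i : Fin n) :
    v i ^ n = ∑ k : Fin n, -(∏ l, (Polynomial.X - Polynomial.C (v l))).coeff k * v i ^ (k : ℕ) := by
  nontriviality R
  set P : Polynomial R := ∏ l, (Polynomial.X - Polynomial.C (v l)) with hP
  have hdeg : P.natDegree = n := by simp [hP]
  have hmonic : P.Monic := Polynomial.monic_prod_of_monic _ _ fun l _ => Polynomial.monic_X_sub_C _
  have hroot : P.eval (v i) = 0 := by
    rw [hP, Polynomial.eval_prod]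
    exact Finset.prod_eq_zero (Finset.mem_univ i) (by simp)
  rw [hmonic.as_sum, hdeg, ← Fin.sum_univ_eq_sum_range
    fun k => Polynomial.C (P.coeff k) * Polynomial.X ^ k] at hroot
  simpa [Polynomial.eval_finsetSum, add_eq_zero_iff_eq_neg] using hroot

theorem det_generalizedVandermonde_snoc_val (v : Fin (n + 1) → R) :
    (generalizedVandermonde v (Fin.snoc (fun j : Fin n => (j : ℕ)) (n + 1))).det =
      (∑ i, v i) * (vandermonde v).det := by
  set P : Polynomial R := ∏ i, (Polynomial.X - Polynomial.C (v i)) with hP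
  have hcoeff : -P.coeff n = ∑ i, v i := by
    have h := Polynomial.prod_X_sub_C_coeff_card_pred Finset.univ v (by simp)
    simpa [neg_eq_iff_eq_neg] using h
  rw [← hcoeff, ← smul_eq_mul]
  refine Eq.trans ?_ (det_updateCol_sum (vandermonde v) (Fin.last n) fun k => -P.coeff k)
  congr 1
  ext i j
  cases j using Fin.lastCases with
  | last => simp [generalizedVandermonde, pow_eq_sum_neg_coeff_prod_X_sub_C v i, hP]
  | cast j => simp [generalizedVandermonde, Fin.castSucc_ne_last]

end Determinants

section Integration

theorem integral_det_pi {ι 𝕜 : Type*} [Fintype ι] [DecidableEq ι] [RCLike 𝕜] {E : ι → Type*}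
    [∀ i, MeasurableSpace (E i)] {μ : ∀ i, Measure (E i)} [∀ i, SigmaFinite (μ i)]
    {f : ∀ i, ι → E i → 𝕜} (hf : ∀ i j, Integrable (f i j) (μ i)) :
    ∫ t, (of fun i j => f i j (t i)).det ∂Measure.pi μ =
      (of fun i j => ∫ s, f i j s ∂μ i).det := by
  simp_rw [← det_transpose (of _), det_apply', transpose_apply, of_apply]
  rw [integral_finsetSum _ fun σ _ =>
    (Integrable.fintype_prod_dep fun i => hf i (σ i)).const_mul _]
  refine Finset.sum_congr rfl fun σ _ => ?_
  rw [integral_const_mul, integral_fintype_prod_eq_prod fun i => f i (σ i)]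

theorem exp_mul_integral_le_integral_mul_exp {α : Type*} [MeasurableSpace α] {μ : Measure α}
    {w g : α → ℝ} {m : ℝ} (hw : 0 ≤ᵐ[μ] w) (hw_int : Integrable w μ)
    (hgw_int : Integrable (fun t => g t * w t) μ)
    (hexp_int : Integrable (fun t => w t * Real.exp (g t)) μ)
    (hm : ∫ t, g t * w t ∂μ = m * ∫ t, w t ∂μ) :
    Real.exp m * ∫ t, w t ∂μ ≤ ∫ t, w t * Real.exp (g t) ∂μ := by
  have htangent : ∀ s, Real.exp m * (s + (1 - m)) ≤ Real.exp s := fun s =>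
    calc Real.exp m * (s + (1 - m)) ≤ Real.exp m * Real.exp (s - m) := by
          gcongr
          linarith [Real.add_one_le_exp (s - m)]
      _ = Real.exp s := by rw [← Real.exp_add, add_sub_cancel]
  calc Real.exp m * ∫ t, w t ∂μ
      = ∫ t, Real.exp m * (g t * w t + (1 - m) * w t) ∂μ := by
        rw [integral_const_mul, integral_add hgw_int (hw_int.const_mul _), integral_const_mul, hm]
        ring
    _ ≤ ∫ t, w t * Real.exp (g t) ∂μ := by
        refine integral_mono_ae ((hgw_int.add (hw_int.const_mul _)).const_mul _) hexp_int ?_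
        filter_upwards [hw] with t ht
        calc Real.exp m * (g t * w t + (1 - m) * w t)
            = w t * (Real.exp m * (g t + (1 - m))) := by ring
          _ ≤ w t * Real.exp (g t) := mul_le_mul_of_nonneg_left (htangent _) ht

end Integration

section InterlacingBox

variable {n : ℕ}

/-- The box of points `t` interlacing the tuple `x`, that is, `x_i ≤ t_i ≤ x_{i+1}` for all `i`:
the domain of integration in all the recursions on the number of nodes. -/
def interlacingBox {α : Type*} [Preorder α] (x : Fin (n + 1) → α) : Set (Fin n → α) :=
  Set.Icc (Fin.init x) (Fin.tail x)

theorem monotone_of_mem_interlacingBox {α : Type*} [Preorder α] {x : Fin (n + 1) → α}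
    (hx : Monotone x) {t : Fin n → α} (ht : t ∈ interlacingBox x) : Monotone t := by
  intro i j hij
  rcases hij.eq_or_lt with rfl | hlt
  · exact le_rfl
  · calc t i ≤ x i.succ := ht.2 i
      _ ≤ x j.castSucc := hx (Fin.succ_le_castSucc_iff.2 hlt)
      _ ≤ t j := ht.1 j

theorem measurableSet_interlacingBox (x : Fin (n + 1) → ℝ) : MeasurableSet (interlacingBox x) :=
  measurableSet_Icc

theorem integrableOn_interlacingBox {E : Type*} [NormedAddCommGroup E] {f : (Fin n → ℝ) → E}
    (hf : Continuous f) (x : Fin (n + 1) → ℝ) : IntegrableOn f (interlacingBox x) :=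
  hf.integrableOn_Icc

theorem setIntegral_interlacingBox_mono {f g : (Fin n → ℝ) → ℝ} (hf : Continuous f)
    (hg : Continuous g) {x : Fin (n + 1) → ℝ} (hfg : ∀ t ∈ interlacingBox x, f t ≤ g t) :
    ∫ t in interlacingBox x, f t ≤ ∫ t in interlacingBox x, g t :=
  setIntegral_mono_on (integrableOn_interlacingBox hf x)
    (integrableOn_interlacingBox hg x) (measurableSet_interlacingBox x) hfg

theorem det_eq_setIntegral_det_deriv {𝕜 : Type*} [RCLike 𝕜] {F : Fin (n + 1) → ℝ → 𝕜}
    {f : Fin n → ℝ → 𝕜} (hF_zero : ∀ s, F 0 s = 1)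
    (hF_succ : ∀ j s, HasDerivAt (F j.succ) (f j s) s) (hf : ∀ j, LocallyIntegrable (f j))
    {x : Fin (n + 1) → ℝ} (hx : Monotone x) :
    (of fun i j => F j (x i)).det = ∫ t in interlacingBox x, (of fun i j => f j (t i)).det := by
  have hIcc : ∀ i j : Fin n, IntegrableOn (f j) (Set.Icc (x i.castSucc) (x i.succ)) :=
    fun i j => (hf j).integrableOn_isCompact isCompact_Icc
  have hpi : (volume : Measure (Fin n → ℝ)).restrict (interlacingBox x) =
      Measure.pi fun i => volume.restrict (Set.Icc (x i.castSucc) (x i.succ)) := by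
    rw [interlacingBox, ← Set.pi_univ_Icc, volume_pi, Measure.restrict_pi_pi]
    rfl
  rw [hpi, integral_det_pi hIcc, det_eq_det_sub_of_col_zero_eq_one _ fun i => hF_zero (x i)]
  congr 1
  ext i j
  have hle : x i.castSucc ≤ x i.succ := hx (Fin.castSucc_le_succ i)
  simp only [of_apply]
  rw [integral_Icc_eq_integral_Ioc, ← intervalIntegral.integral_of_le hle,
    intervalIntegral.integral_eq_sub_of_hasDerivAt (fun s _ => hF_succ j s)
      ((intervalIntegrable_iff_integrableOn_Icc_of_le hle).2 (hIcc i j))]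

theorem det_generalizedVandermonde_cons_zero {x : Fin (n + 1) → ℝ} (hx : Monotone x)
    (a : Fin n → ℕ) :
    (generalizedVandermonde x (Fin.cons 0 fun j => a j + 1)).det =
      (∏ j, (a j + 1 : ℝ)) * ∫ t in interlacingBox x, (generalizedVandermonde t a).det := by
  rw [← integral_const_mul]
  simp_rw [← det_mul_row]
  exact det_eq_setIntegral_det_deriv
    (F := fun j s => s ^ (Fin.cons 0 (fun j => a j + 1) : Fin (n + 1) → ℕ) j) (by simp)
    (fun j s => by simpa using hasDerivAt_pow (a j + 1) s)
    (fun j => Continuous.locallyIntegrable (by fun_prop)) hx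

end InterlacingBox

section Vandermonde

variable {n : ℕ}

theorem vandermondePoly_eq_det (x : Fin n → ℝ) : vandermondePoly x = (vandermonde x).det :=
  (det_vandermonde x).symm

@[fun_prop]
theorem continuous_vandermondePoly : Continuous (vandermondePoly : (Fin n → ℝ) → ℝ) := by
  unfold vandermondePoly
  fun_prop

theorem vandermondePoly_nonneg {x : Fin n → ℝ} (hx : Monotone x) : 0 ≤ vandermondePoly x :=
  Finset.prod_nonneg fun _ _ => Finset.prod_nonneg fun _ hj =>
    sub_nonneg.2 (hx (Finset.mem_Ioi.1 hj).le)

theorem prod_val_add_one_eq_factorial (n : ℕ) : ∏ j : Fin n, ((j : ℕ) + 1 : ℝ) = n.factorial := by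
  rw [Fin.prod_univ_eq_prod_range (fun j => (j + 1 : ℝ)) n,
    ← Finset.prod_range_add_one_eq_factorial]
  push_cast
  rfl

theorem cons_zero_val_add_one (n : ℕ) :
    (Fin.cons 0 fun j : Fin n => (j : ℕ) + 1) = ((↑) : Fin (n + 1) → ℕ) := by
  ext j
  cases j using Fin.cases <;> simp

theorem vandermondePoly_eq_factorial_mul_setIntegral {x : Fin (n + 1) → ℝ} (hx : Monotone x) :
    vandermondePoly x = n.factorial * ∫ t in interlacingBox x, vandermondePoly t := by
  have h := det_generalizedVandermonde_cons_zero hx fun j => (j : ℕ)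
  rw [cons_zero_val_add_one, prod_val_add_one_eq_factorial] at h
  simp_rw [vandermondePoly_eq_det]
  exact h

theorem sum_mul_vandermondePoly_eq_setIntegral {x : Fin (n + 2) → ℝ} (hx : Monotone x) :
    (∑ i, x i) * vandermondePoly x =
      n.factorial * (n + 2) * ∫ t in interlacingBox x, (∑ i, t i) * vandermondePoly t := by
  let a : Fin (n + 1) → ℕ := Fin.snoc (fun j : Fin n => (j : ℕ)) (n + 1)
  have hexponents : (Fin.cons 0 fun j => a j + 1) =
      (Fin.snoc (fun j : Fin (n + 1) => (j : ℕ)) (n + 2) : Fin (n + 2) → ℕ) := by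
    rw [← cons_zero_val_add_one, ← Fin.cons_snoc_eq_snoc_cons]
    congr 1
    exact Fin.comp_snoc (· + 1) _ _
  have hprod : ∏ j, (a j + 1 : ℝ) = n.factorial * (n + 2) := by
    simp only [a, Fin.prod_univ_castSucc, Fin.snoc_castSucc, Fin.snoc_last,
      prod_val_add_one_eq_factorial]
    push_cast
    ring
  have h := det_generalizedVandermonde_cons_zero hx a
  rw [hexponents, hprod] at h
  simpa only [a, det_generalizedVandermonde_snoc_val, ← vandermondePoly_eq_det] using h

theorem setIntegral_sum_mul_vandermondePoly {x : Fin (n + 2) → ℝ} (hx : Monotone x) :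
    ∫ t in interlacingBox x, (∑ i, t i) * vandermondePoly t =
      (n + 1) / (n + 2) * (∑ i, x i) * ∫ t in interlacingBox x, vandermondePoly t := by
  have hfac : (n.factorial : ℝ) ≠ 0 := Nat.cast_ne_zero.2 n.factorial_ne_zero
  have h := sum_mul_vandermondePoly_eq_setIntegral hx
  rw [vandermondePoly_eq_factorial_mul_setIntegral hx, Nat.factorial_succ] at h
  push_cast at h
  field_simp
  refine mul_left_cancel₀ hfac ?_
  linear_combination -h

end Vandermonde

section ShiftedTail

variable {n : ℕ}

/-- The differences `y_j - y_0` for `j ≥ 1`: the second family of nodes left after the matrix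
`[e^{x_i y_j}]` has been normalized to have a constant first column. -/
def shiftedTail {G : Type*} [Sub G] (y : Fin (n + 1) → G) : Fin n → G :=
  fun j => y j.succ - y 0

theorem shiftedTail_nonneg {G : Type*} [AddCommGroup G] [PartialOrder G] [IsOrderedAddMonoid G]
    {y : Fin (n + 1) → G} (hy : Monotone y) (j : Fin n) : 0 ≤ shiftedTail y j :=
  sub_nonneg.2 (hy (Fin.zero_le _))

theorem monotone_shiftedTail {G : Type*} [AddCommGroup G] [PartialOrder G] [IsOrderedAddMonoid G]
    {y : Fin (n + 1) → G} (hy : Monotone y) : Monotone (shiftedTail y) :=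
  fun _ _ hij => sub_le_sub_right (hy (Fin.succ_le_succ_iff.2 hij)) _

theorem sum_shiftedTail {R : Type*} [CommRing R] (y : Fin (n + 1) → R) :
    ∑ j, shiftedTail y j = ∑ j, y j - (n + 1) * y 0 := by
  simp only [shiftedTail, Finset.sum_sub_distrib, Finset.sum_const, Finset.card_univ,
    Fintype.card_fin, nsmul_eq_mul, Fin.sum_univ_succ y]
  ring

theorem sum_mul_eq_add_sum_tail_mul_shiftedTail {R : Type*} [CommRing R] (x y : Fin (n + 1) → R) :
    ∑ i, x i * y i = (∑ i, x i) * y 0 + ∑ i, Fin.tail x i * shiftedTail y i := by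
  simp only [Fin.sum_univ_succ, Fin.tail, shiftedTail, mul_sub, Finset.sum_sub_distrib,
    ← Finset.sum_mul]
  ring

theorem vandermondePoly_succ (y : Fin (n + 1) → ℝ) :
    vandermondePoly y = (∏ j, shiftedTail y j) * vandermondePoly (shiftedTail y) := by
  simp [vandermondePoly, shiftedTail, Fin.prod_univ_succ, Fin.prod_Ioi_succ]

end ShiftedTail

section LeadingTerm

variable {n : ℕ}

/-- The product `V(x) V(y) / c_n`: the lowest-order term of `det [e^{x_i y_j}]` as the nodes tend
to `0`, and the factor common to both bounds. -/
noncomputable def leadingTerm (x y : Fin n → ℝ) : ℝ :=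
  1 / (superfactConst n : ℝ) * vandermondePoly x * vandermondePoly y

theorem superfactConst_pos (n : ℕ) : 0 < superfactConst n :=
  Finset.prod_pos fun _ _ => Nat.factorial_pos _

theorem superfactConst_succ : ∀ n : ℕ, superfactConst (n + 1) = superfactConst n * n.factorial
  | 0 => rfl
  | n + 1 => Finset.prod_Icc_succ_top (Nat.le_add_left 1 n) _

theorem leadingTerm_nonneg {x y : Fin n → ℝ} (hx : Monotone x) (hy : Monotone y) :
    0 ≤ leadingTerm x y :=
  mul_nonneg (mul_nonneg (by positivity) (vandermondePoly_nonneg hx)) (vandermondePoly_nonneg hy)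

@[fun_prop]
theorem continuous_leadingTerm_left (y : Fin n → ℝ) : Continuous fun x => leadingTerm x y := by
  unfold leadingTerm
  fun_prop

theorem leadingTerm_succ {x : Fin (n + 1) → ℝ} (hx : Monotone x) (y : Fin (n + 1) → ℝ) :
    leadingTerm x y =
      (∏ j, shiftedTail y j) * ∫ t in interlacingBox x, leadingTerm t (shiftedTail y) := by
  have hc : (superfactConst n : ℝ) ≠ 0 := Nat.cast_ne_zero.2 (superfactConst_pos n).ne'
  have hfac : (n.factorial : ℝ) ≠ 0 := Nat.cast_ne_zero.2 n.factorial_ne_zero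
  simp only [leadingTerm]
  rw [integral_mul_const, integral_const_mul, superfactConst_succ,
    vandermondePoly_eq_factorial_mul_setIntegral hx, vandermondePoly_succ y]
  push_cast
  field_simp

theorem setIntegral_sum_mul_leadingTerm {x : Fin (n + 2) → ℝ} (hx : Monotone x)
    (z : Fin (n + 1) → ℝ) :
    ∫ t in interlacingBox x, (∑ i, t i) * leadingTerm t z =
      (n + 1) / (n + 2) * (∑ i, x i) * ∫ t in interlacingBox x, leadingTerm t z := by
  have hfactor : ∀ t, (∑ i, t i) * leadingTerm t z =
      1 / (superfactConst (n + 1) : ℝ) * ((∑ i, t i) * vandermondePoly t) * vandermondePoly z :=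
    fun t => by rw [leadingTerm]; ring
  simp_rw [hfactor, leadingTerm, integral_mul_const, integral_const_mul,
    setIntegral_sum_mul_vandermondePoly hx]
  ring

end LeadingTerm

section ExpMatrix

variable {n : ℕ}

@[fun_prop]
theorem continuous_det_expMatrix_left (y : Fin n → ℝ) :
    Continuous fun x => (expMatrix x y).det := by
  unfold expMatrix
  refine Continuous.matrix_det (continuous_matrix fun i j => ?_)
  simp only [of_apply]
  fun_prop

theorem det_expMatrix_eq_exp_mul_det_expMatrix_sub (x y : Fin n → ℝ) (c : ℝ) :
    (expMatrix x y).det = Real.exp ((∑ i, x i) * c) * (expMatrix x fun j => y j - c).det := by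
  rw [Finset.sum_mul, Real.exp_sum, ← det_mul_column]
  congr 1
  ext i j
  simp only [expMatrix, of_apply, ← Real.exp_add]
  ring_nf

theorem det_expMatrix_eq_prod_tail_mul_setIntegral {x y : Fin (n + 1) → ℝ} (hx : Monotone x)
    (hy : y 0 = 0) :
    (expMatrix x y).det =
      (∏ j, Fin.tail y j) * ∫ t in interlacingBox x, (expMatrix t (Fin.tail y)).det := by
  rw [← integral_const_mul]
  simp_rw [← det_mul_row]
  exact det_eq_setIntegral_det_deriv (F := fun j s => Real.exp (s * y j)) (by simp [hy])
    (fun j s => by simpa [Fin.tail, mul_comm] using ((hasDerivAt_id s).mul_const (y j.succ)).exp)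
    (fun j => Continuous.locallyIntegrable (by fun_prop)) hx

theorem det_expMatrix_succ {x : Fin (n + 1) → ℝ} (hx : Monotone x) (y : Fin (n + 1) → ℝ) :
    (expMatrix x y).det = Real.exp ((∑ i, x i) * y 0) *
      ((∏ j, shiftedTail y j) * ∫ t in interlacingBox x, (expMatrix t (shiftedTail y)).det) := by
  rw [det_expMatrix_eq_exp_mul_det_expMatrix_sub x y (y 0),
    det_expMatrix_eq_prod_tail_mul_setIntegral hx (sub_self _)]
  rfl

theorem det_expMatrix_le_leadingTerm_mul_exp {x y : Fin n → ℝ} (hx : Monotone x)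
    (hy : Monotone y) :
    (expMatrix x y).det ≤ leadingTerm x y * Real.exp (∑ i, x i * y i) := by
  induction n with
  | zero => simp [leadingTerm, superfactConst, vandermondePoly]
  | succ n ih =>
    set z := shiftedTail y
    have hz : Monotone z := monotone_shiftedTail hy
    have hz_nonneg : ∀ j, 0 ≤ z j := shiftedTail_nonneg hy
    have hprod : 0 ≤ ∏ j, z j := Finset.prod_nonneg fun j _ => hz_nonneg j
    have hbound : ∀ t ∈ interlacingBox x,
        (expMatrix t z).det ≤ leadingTerm t z * Real.exp (∑ i, Fin.tail x i * z i) := by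
      intro t ht
      have htm := monotone_of_mem_interlacingBox hx ht
      have hL := leadingTerm_nonneg htm hz
      refine (ih htm hz).trans ?_
      gcongr with i
      · exact hz_nonneg i
      · exact ht.2 i
    calc (expMatrix x y).det
        = Real.exp ((∑ i, x i) * y 0) *
            ((∏ j, z j) * ∫ t in interlacingBox x, (expMatrix t z).det) := det_expMatrix_succ hx y
      _ ≤ Real.exp ((∑ i, x i) * y 0) * ((∏ j, z j) * ∫ t in interlacingBox x,
            leadingTerm t z * Real.exp (∑ i, Fin.tail x i * z i)) := by
          have hint := setIntegral_interlacingBox_mono (by fun_prop) (by fun_prop) hbound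
          gcongr
      _ = leadingTerm x y * Real.exp (∑ i, x i * y i) := by
          rw [integral_mul_const, sum_mul_eq_add_sum_tail_mul_shiftedTail, Real.exp_add,
            leadingTerm_succ hx]
          ring

theorem exp_mul_setIntegral_leadingTerm_le {x : Fin (n + 2) → ℝ} (hx : Monotone x)
    {z : Fin (n + 1) → ℝ} (hz : Monotone z) :
    Real.exp ((∑ i, x i) * (∑ j, z j) / (n + 2)) * ∫ t in interlacingBox x, leadingTerm t z ≤
      ∫ t in interlacingBox x,
        leadingTerm t z * Real.exp ((∑ i, t i) * (∑ j, z j) / (n + 1)) := by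
  refine exp_mul_integral_le_integral_mul_exp
    (ae_restrict_of_forall_mem (measurableSet_interlacingBox x) fun t ht =>
      leadingTerm_nonneg (monotone_of_mem_interlacingBox hx ht) hz)
    (integrableOn_interlacingBox (by fun_prop) x)
    (integrableOn_interlacingBox (by fun_prop) x)
    (integrableOn_interlacingBox (by fun_prop) x) ?_
  calc ∫ t in interlacingBox x, (∑ i, t i) * (∑ j, z j) / (n + 1) * leadingTerm t z
      = (∑ j, z j) / (n + 1) * ∫ t in interlacingBox x, (∑ i, t i) * leadingTerm t z := by
        rw [← integral_const_mul]
        congr 1 with t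
        ring
    _ = (∑ i, x i) * (∑ j, z j) / (n + 2) * ∫ t in interlacingBox x, leadingTerm t z := by
        rw [setIntegral_sum_mul_leadingTerm hx]
        field_simp

theorem leadingTerm_mul_exp_mean_le_det_expMatrix {x y : Fin (n + 1) → ℝ} (hx : Monotone x)
    (hy : Monotone y) :
    leadingTerm x y * Real.exp ((∑ i, x i) * (∑ j, y j) / (n + 1 : ℕ)) ≤ (expMatrix x y).det := by
  induction n with
  | zero => simp [expMatrix, leadingTerm, superfactConst, vandermondePoly]
  | succ n ih =>
    set z := shiftedTail y with hz_def
    have hz : Monotone z := monotone_shiftedTail hy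
    have hprod : 0 ≤ ∏ j, z j := Finset.prod_nonneg fun j _ => shiftedTail_nonneg hy j
    have hexponent : (∑ i, x i) * (∑ j, y j) / (n + 1 + 1 : ℕ) =
        (∑ i, x i) * y 0 + (∑ i, x i) * (∑ j, z j) / (n + 2) := by
      rw [hz_def, sum_shiftedTail]
      push_cast
      field_simp
      ring
    have hbound : ∀ t ∈ interlacingBox x,
        leadingTerm t z * Real.exp ((∑ i, t i) * (∑ j, z j) / (n + 1)) ≤ (expMatrix t z).det :=
      fun t ht => by exact_mod_cast ih (monotone_of_mem_interlacingBox hx ht) hz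
    calc leadingTerm x y * Real.exp ((∑ i, x i) * (∑ j, y j) / (n + 1 + 1 : ℕ))
        = Real.exp ((∑ i, x i) * y 0) * ((∏ j, z j) *
            (Real.exp ((∑ i, x i) * (∑ j, z j) / (n + 2)) *
              ∫ t in interlacingBox x, leadingTerm t z)) := by
          rw [hexponent, Real.exp_add, leadingTerm_succ hx]
          ring
      _ ≤ Real.exp ((∑ i, x i) * y 0) * ((∏ j, z j) * ∫ t in interlacingBox x,
            leadingTerm t z * Real.exp ((∑ i, t i) * (∑ j, z j) / (n + 1))) := by
          have hjensen := exp_mul_setIntegral_leadingTerm_le hx hz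
          gcongr
      _ ≤ Real.exp ((∑ i, x i) * y 0) *
            ((∏ j, z j) * ∫ t in interlacingBox x, (expMatrix t z).det) := by
          have hint := setIntegral_interlacingBox_mono (by fun_prop) (by fun_prop) hbound
          gcongr
      _ = (expMatrix x y).det := (det_expMatrix_succ hx y).symm

end ExpMatrix

theorem theorem1 (n : ℕ) (hn : 1 ≤ n) (x y : Fin n → ℝ)
    (hx : StrictMono x) (hy : StrictMono y) :
    1 / (superfactConst n : ℝ) * vandermondePoly x * vandermondePoly y *
        Real.exp ((∑ i, x i) * (∑ j, y j) / (n : ℝ)) ≤ (expMatrix x y).det ∧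
    (expMatrix x y).det ≤
      1 / (superfactConst n : ℝ) * vandermondePoly x * vandermondePoly y *
        Real.exp (∑ i, x i * y i) := by
  obtain ⟨m, rfl⟩ := Nat.exists_eq_add_of_le' hn
  exact ⟨leadingTerm_mul_exp_mean_le_det_expMatrix hx.monotone hy.monotone,
    det_expMatrix_le_leadingTerm_mul_exp hx.monotone hy.monotone⟩
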